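/- Let $G$ be a finite group of order $k$. For $n\ge 1$ put $N=n(k-1)$, and let $E_NG=G*\dots*G$ be the $(N+1)$-fold join of the $0$-dimensional simplicial complex $G$ with itself: its vertices are the pairs $(g,i)\in G\times[N+1]$, and a nonempty set of vertices is a simplex if it contains at most one vertex $(g,i)$ for each $i$. It is realized geometrically in $\mathbb R^{G\times[N+1]}$ with the standard basis vectors as vertices, and $G$ acts on it diagonally, by $h\cdot(g,i)=(hg,i)$. Let $W_G=\{x\in\mathbb R[G] : \sum_{g\in G}x_g=0\}$, a subrepresentation of the real regular representation $\mathbb R[G]$ with basis $(e_g)_{g\in G}$. The generalized crosspolytope $\Diamond_G^n\subset (W_G)^n$ is the convex hull of $\bigcup_{i=1}^n\Delta_{(i)}$, where $\Delta_{(i)}$ is the simplex in the $i$-th copy of $W_G$ spanned by the orthogonal projections $e_g-\frac1k\sum_{h\in G}e_h$, $g\in G$, of the basis vectors. $G$ has the Borsuk–Ulam property if for every $n\ge 1$ every continuous $G$-equivariant map $f:E_NG\to (W_G)^n$ has a zero. $G$ has the Tucker property if for every $n\ge1$, every $G$-invariant subdivision $K$ of $E_NG$ (a finite geometric simplicial complex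 with the same underlying space as $E_NG$, each of whose simplices lies in a simplex of $E_NG$, and such that $g\cdot\sigma\in K$ for all $g\in G$ and $\sigma\in K$) and every $G$-equivariant map $\phi$ from the vertices of $K$ to the vertices of $\Diamond_G^n$, there is a simplex $\sigma\in K$ such that $0$ lies in the convex hull of the labels $\phi(v)$ of the vertices $v$ of $\sigma$. Theorem. If a finite group $G$ has the Tucker property, then it has the Borsuk–Ulam property. The converse also holds, so that the two properties of $G$ are equivalent. -/

import Mathlib

namespace TuckerBU

open Geometry

noncomputable section

/-! ### Borsuk-Ulam pairs and Tucker triples -/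

section General

variable {G E V : Type*} [Group G]
  [AddCommGroup E] [Module ℝ E] [AddCommGroup V] [Module ℝ V]

/-- `K` is a subdivision of the complex `L`: a finite simplicial complex with the same underlying
space, each simplex of which lies in a simplex of `L`. -/
structure IsSubdivision (K L : SimplicialComplex ℝ E) : Prop where
  finite : K.faces.Finite
  space_eq : K.space = L.space
  refines : ∀ s ∈ K.faces, ∃ t ∈ L.faces,
    convexHull ℝ (s : Set E) ⊆ convexHull ℝ (t : Set E)

/-- `K` is `G`-invariant, where `G` acts linearly on the ambient space through `ρ`: if `σ` is a
simplex of `K`, then so is `g • σ`, for every `g`. -/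
def IsInvariant (ρ : Representation ℝ G E) (K : SimplicialComplex ℝ E) : Prop :=
  ∀ g : G, ∀ s ∈ K.faces, ∃ t ∈ K.faces, (t : Set E) = ρ g '' (s : Set E)

/-- `(K, V)` is a Borsuk-Ulam pair for `G`: every continuous `G`-equivariant map from the
underlying space of `K` to `V` has a zero. -/
def IsBorsukUlamPair [TopologicalSpace E] [TopologicalSpace V]
    (ρ : Representation ℝ G E) (K : SimplicialComplex ℝ E) (τ : Representation ℝ G V) : Prop :=
  ∀ f : E → V, ContinuousOn f K.space → (∀ g : G, ∀ x ∈ K.space, f (ρ g x) = τ g (f x)) →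
    ∃ x ∈ K.space, f x = 0

/-- `(K, V, Q)` is a Tucker triple for `G`: for every `G`-equivariant labelling `φ` of the vertices
of `K` by vertices (that is, extreme points) of the polytope `Q ⊆ V` there is a simplex of `K` such
that `0` lies in the convex hull of the labels of its vertices. -/
def IsTuckerTriple (ρ : Representation ℝ G E) (K : SimplicialComplex ℝ E)
    (τ : Representation ℝ G V) (Q : Set V) : Prop :=
  ∀ φ : E → V, (∀ v ∈ K.vertices, φ v ∈ Q.extremePoints ℝ) →
    (∀ g : G, ∀ v ∈ K.vertices, φ (ρ g v) = τ g (φ v)) →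
    ∃ s ∈ K.faces, (0 : V) ∈ convexHull ℝ (φ '' (s : Set E))

end General

/-! ### The complex `E_N G` -/

section Join

variable (G : Type*) [Group G]

/-- The diagonal action of `G` on `ℝ^(G × [m])`, permuting the basis vectors by
`g • e_(h, i) = e_(g * h, i)`. -/
def joinRep (m : ℕ) : Representation ℝ G (G × Fin m → ℝ) where
  toFun g := LinearMap.funLeft ℝ ℝ fun p : G × Fin m => (g⁻¹ * p.1, p.2)
  map_one' := by ext; simp
  map_mul' g h := by ext; simp [mul_assoc, LinearMap.funLeft_apply]

open Classical in
/-- The `m`-fold join of the `0`-dimensional complex `G` with itself, geometrically realized in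
`ℝ^(G × [m])`: the vertices are the standard basis vectors `e_(g, i)`, and a nonempty set of
vertices spans a simplex if it has at most one vertex in each of the `m` copies of `G`. -/
def joinComplex (m : ℕ) : SimplicialComplex ℝ (G × Fin m → ℝ) :=
  SimplicialComplex.ofAffineIndependent
    { faces := {s | ∃ c : Finset (G × Fin m), c.Nonempty ∧ Set.InjOn Prod.snd (c : Set (G × Fin m)) ∧
        s = c.image fun p => (Pi.single p 1 : G × Fin m → ℝ)}
      isRelLowerSet_faces := by
        rintro _ ⟨c, hc, hinj, rfl⟩
        refine ⟨hc.image _, fun t hts ht => ?_⟩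
        obtain ⟨d, hd, rfl⟩ := Finset.subset_image_iff.mp hts
        exact ⟨d, Finset.image_nonempty.mp ht, hinj.mono (by exact_mod_cast hd), rfl⟩ }
    (by
      refine (Pi.linearIndependent_single_one (G × Fin m) ℝ).affineIndependent.range.mono
        fun x hx => ?_
      simp only [Set.mem_iUnion, Finset.mem_coe] at hx
      obtain ⟨_, ⟨c, _, _, rfl⟩, hx⟩ := hx
      obtain ⟨p, _, rfl⟩ := Finset.mem_image.mp hx
      exact ⟨p, rfl⟩)

end Join

/-! ### The representation `(W_G)^n` and the generalized crosspolytope -/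

section Crosspolytope

variable (G : Type*) [Group G] [Fintype G]

/-- The real regular representation `ℝ[G]`, with `g • e_h = e_(g * h)`. -/
def regularRep : Representation ℝ G (G → ℝ) where
  toFun g := LinearMap.funLeft ℝ ℝ fun h : G => g⁻¹ * h
  map_one' := by ext; simp
  map_mul' g h := by ext; simp [mul_assoc, LinearMap.funLeft_apply]

/-- `W_G`, the space of all `x` in `ℝ[G]` whose coordinates sum to `0`. -/
def W : Submodule ℝ (G → ℝ) where
  carrier := {x | ∑ h, x h = 0}
  add_mem' {x y} hx hy := by
    simp only [Set.mem_ofPred_eq] at hx hy ⊢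
    simp [Finset.sum_add_distrib, hx, hy]
  zero_mem' := by simp
  smul_mem' c x hx := by
    simp only [Set.mem_ofPred_eq] at hx ⊢
    simp [← Finset.mul_sum, hx]

/-- `W_G` as a subrepresentation of the regular representation. -/
def wRep : Representation ℝ G (W G) :=
  (regularRep G).subrepresentation (W G) fun g x (hx : ∑ h, x h = 0) =>
    show ∑ h, x (g⁻¹ * h) = 0 from
      (Fintype.sum_equiv (Equiv.mulLeft g⁻¹) _ _ fun _ => rfl).trans hx

/-- The representation `(W_G)^n`, with `G` acting on each of the `n` copies of `W_G`. -/
def wPowRep (n : ℕ) : Representation ℝ G (Fin n → W G) where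
  toFun g := LinearMap.piMap fun _ => wRep G g
  map_one' := by ext; simp
  map_mul' g h := by ext; simp

open Classical in
/-- The orthogonal projection `e_g - (1 / k) ∑ h, e_h` of the basis vector `e_g` of `ℝ[G]` to
`W_G`, where `k` is the order of `G`. -/
def wVertex (g : G) : W G :=
  ⟨fun h => (Pi.single g 1 : G → ℝ) h - 1 / (Fintype.card G : ℝ),
    show ∑ h, ((Pi.single g 1 : G → ℝ) h - 1 / (Fintype.card G : ℝ)) = 0 by
      simp [Finset.sum_sub_distrib]⟩

/-- The generalized crosspolytope in `(W_G)^n`: the convex hull of the union of the simplices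
`Δ_(i)`, where `Δ_(i)` lies in the `i`-th copy of `W_G` and is spanned there by the projections of
the basis vectors of `ℝ[G]`. -/
def crosspolytope (n : ℕ) : Set (Fin n → W G) :=
  convexHull ℝ (⋃ i : Fin n, convexHull ℝ
    (Set.range fun g : G => (Pi.single i (wVertex G g) : Fin n → W G)))

/-! ### The two properties of a finite group -/

/-- The Borsuk-Ulam property of `G`: for `k = |G|`, every `n ≥ 1` and `N = n * (k - 1)`, the pair
`(E_N G, (W_G)^n)` is a Borsuk-Ulam pair, where `E_N G` is the `(N + 1)`-fold join of `G`. -/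
def BorsukUlamProperty : Prop :=
  ∀ n : ℕ, 1 ≤ n →
    IsBorsukUlamPair (joinRep G (n * (Fintype.card G - 1) + 1))
      (joinComplex G (n * (Fintype.card G - 1) + 1)) (wPowRep G n)

/-- The Tucker property of `G`: for `k = |G|`, every `n ≥ 1`, `N = n * (k - 1)` and every
`G`-invariant subdivision `K` of `E_N G`, the triple consisting of `K`, `(W_G)^n` and the
generalized crosspolytope is a Tucker triple. -/
def TuckerProperty : Prop :=
  ∀ n : ℕ, 1 ≤ n →
    ∀ K : SimplicialComplex ℝ (G × Fin (n * (Fintype.card G - 1) + 1) → ℝ),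
      IsSubdivision K (joinComplex G (n * (Fintype.card G - 1) + 1)) →
      IsInvariant (joinRep G (n * (Fintype.card G - 1) + 1)) K →
      IsTuckerTriple (joinRep G (n * (Fintype.card G - 1) + 1)) K (wPowRep G n)
        (crosspolytope G n)

end Crosspolytope

end

end TuckerBU

/-! Borsuk–Ulam implies Tucker: extend the labelling affinely over each simplex of `K` to a
continuous equivariant map. It has a zero, and on the simplex containing that zero the value 0 is a
convex combination of the labels.

Tucker implies Borsuk–Ulam: suppose `f` has no zero. In each copy of `W G` the coordinates sum to 0,
so a nonzero value has a positive coordinate, and by compactness some coordinate is at least a fixed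
`δ > 0` at every point. Take an invariant subdivision so fine that `f` varies by less than `δ` on
the vertices of a simplex, and label each vertex by a pair `(i, g)` whose coordinate is at least
`δ`; the action is free, so this can be done equivariantly. If 0 is in the hull of the labels of a
simplex, then all labels of one copy `i` occur there (`exists_forall_label_mem`). Hence at any
vertex of the simplex all coordinates in copy `i` are positive, although they sum to 0.

The fine subdivision (`exists_fine_invariant_subdivision`) is a grid. A point of the join is given
by its partial sums over the copies of `G` and by one group element for each copy that carries
weight. Round each partial sum `t` to `⌊m t + θ⌋ / m` with a common shift `θ ∈ [0, 1)`; the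
roundings of one point, and all nonempty sets of them, form the simplices. Averaging over `θ`
recovers the point, so the simplices cover the join. As `θ` grows the roundings form a chain, which
makes convex representations unique (`hasUniqueWeights_gridFaces`). The action leaves partial sums
unchanged, so the grid is invariant. -/

namespace TuckerBU

open Geometry

/-! ### Extending labellings of the vertices to continuous maps -/

section Extension

/-- A map on an affinely independent finite set extends to a continuous affine map. -/
theorem exists_continuous_affineMap_extension {E V : Type*} [NormedAddCommGroup E]
    [NormedSpace ℝ E] [FiniteDimensional ℝ E] [AddCommGroup V] [Module ℝ V] [TopologicalSpace V]
    [ContinuousAdd V] [ContinuousSMul ℝ V] {s : Finset E}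
    (hs : AffineIndependent ℝ ((↑) : s → E)) (φ : E → V) :
    ∃ A : E →ᵃ[ℝ] V, Continuous A ∧ ∀ v ∈ s, A v = φ v := by
  classical
  obtain ⟨t, hst, hti, htop⟩ := exists_subset_affineIndependent_affineSpan_eq_top
    (s := (s : Set E)) hs
  let b : AffineBasis t ℝ E := ⟨fun p => p, hti, by simpa using htop⟩
  have : Finite t := finite_set_of_fin_dim_affineIndependent ℝ hti
  cases nonempty_fintype t
  refine ⟨∑ i : t, (LinearMap.toSpanSingleton ℝ V (φ i)).toAffineMap.comp (b.coord i), ?_, ?_⟩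
  · have h : ∀ i, Continuous (b.coord i) := fun i => (b.coord i).continuous_of_finiteDimensional
    have : ⇑(∑ i : t, (LinearMap.toSpanSingleton ℝ V (φ i)).toAffineMap.comp (b.coord i)) =
        fun x => ∑ i : t, b.coord i x • φ i := by
      ext x
      induction (Finset.univ : Finset t) using Finset.induction_on with
      | empty => simp
      | insert a u ha ih => simp [Finset.sum_insert ha, ih]
    rw [this]
    fun_prop
  · intro v hv
    have : ∀ u : Finset t, (∑ i ∈ u, (LinearMap.toSpanSingleton ℝ V (φ i)).toAffineMap.comp
        (b.coord i)) v = ∑ i ∈ u, b.coord i v • φ i := by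
      intro u
      induction u using Finset.induction_on with
      | empty => simp
      | insert a u ha ih => simp [Finset.sum_insert ha, ih]
    rw [this]
    have hb : ∀ i, b.coord i v = if i = ⟨v, hst hv⟩ then 1 else 0 := fun i =>
      b.coord_apply i ⟨v, hst hv⟩
    simp [hb]

/-- Two affine maps that agree on a set agree on its convex hull. -/
theorem eqOn_convexHull_of_eqOn {E V : Type*} [AddCommGroup E] [Module ℝ E] [AddCommGroup V]
    [Module ℝ V] {A B : E →ᵃ[ℝ] V} {s : Set E} (h : Set.EqOn A B s) :
    Set.EqOn A B (convexHull ℝ s) := by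
  have : convexHull ℝ s ⊆ {x | A x = B x} := by
    refine convexHull_min h fun x hx y hy a b _ _ hab => ?_
    simp only [Set.mem_ofPred_eq] at hx hy ⊢
    rw [Convex.combo_affine_apply hab, Convex.combo_affine_apply hab, hx, hy]
  exact this

/-- An equivariant labelling of the vertices of a finite invariant complex extends to a continuous
equivariant map, whose values on every simplex are convex combinations of the labels there. -/
theorem exists_equivariant_extension {G E V : Type*} [Group G] [NormedAddCommGroup E]
    [NormedSpace ℝ E] [FiniteDimensional ℝ E] [AddCommGroup V] [Module ℝ V] [TopologicalSpace V]
    [ContinuousAdd V] [ContinuousSMul ℝ V] (ρ : Representation ℝ G E) (τ : Representation ℝ G V)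
    {K : SimplicialComplex ℝ E} (hfin : K.faces.Finite) (hK : IsInvariant ρ K) (φ : E → V)
    (hφ : ∀ g : G, ∀ v ∈ K.vertices, φ (ρ g v) = τ g (φ v)) :
    ∃ f : E → V, ContinuousOn f K.space ∧ (∀ g : G, ∀ x ∈ K.space, f (ρ g x) = τ g (f x)) ∧
      ∀ s ∈ K.faces, ∀ x ∈ convexHull ℝ (s : Set E), f x ∈ convexHull ℝ (φ '' (s : Set E)) := by
  classical
  choose! A hAc hA using fun (s : Finset E) (hs : s ∈ K.faces) =>
    exists_continuous_affineMap_extension (K.indep hs) φ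
  -- Two simplices meet in the hull of their common vertices, where both affine maps take the
  -- prescribed labels; the value at a point is thus independent of the simplex chosen.
  have hAA : ∀ s ∈ K.faces, ∀ t ∈ K.faces, ∀ x ∈ convexHull ℝ (s : Set E),
      x ∈ convexHull ℝ (t : Set E) → A s x = A t x := fun s hs t ht x hxs hxt =>
    eqOn_convexHull_of_eqOn (fun v hv => (hA s hs v hv.1).trans (hA t ht v hv.2).symm)
      (K.inter_subset_convexHull hs ht ⟨hxs, hxt⟩)
  choose! S hS hxS using fun (x : E) (hx : x ∈ K.space) => SimplicialComplex.mem_space_iff.mp hx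
  have hf : ∀ s ∈ K.faces, ∀ x ∈ convexHull ℝ (s : Set E), A (S x) x = A s x := fun s hs x hx =>
    have hx' := SimplicialComplex.mem_space_iff.mpr ⟨s, hs, hx⟩
    hAA _ (hS x hx') s hs x (hxS x hx') hx
  refine ⟨fun x => A (S x) x, ?_, ?_, ?_⟩
  · have : Finite K.faces := hfin
    have hsp : K.space = ⋃ s : K.faces, convexHull ℝ ((s : Finset E) : Set E) := by
      simp [SimplicialComplex.space, Set.iUnion_subtype]
    rw [hsp]
    refine (locallyFinite_of_finite _).continuousOn_iUnion
      (fun s => s.1.finite_toSet.isClosed_convexHull ℝ) fun s => ?_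
    exact (hAc s s.2).continuousOn.congr fun x hx => hf s s.2 x hx
  · intro g x hx
    obtain ⟨s, hs, hxs⟩ := SimplicialComplex.mem_space_iff.mp hx
    obtain ⟨t, ht, hts⟩ := hK g s hs
    have hgx : ρ g x ∈ convexHull ℝ (t : Set E) := by
      rw [hts, ← LinearMap.image_convexHull]
      exact Set.mem_image_of_mem _ hxs
    simp only [hf s hs x hxs, hf t ht _ hgx]
    -- Both sides are affine in `x`, so equivariance need only be checked at the vertices of `s`.
    refine eqOn_convexHull_of_eqOn (A := (A t).comp (ρ g).toAffineMap)
      (B := (τ g).toAffineMap.comp (A s)) (fun v hv => ?_) hxs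
    have hgv : ρ g v ∈ t := by
      rw [← Finset.mem_coe, hts]
      exact Set.mem_image_of_mem _ hv
    simp only [AffineMap.coe_comp, LinearMap.coe_toAffineMap, Function.comp_apply]
    rw [hA t ht _ hgv, hA s hs v hv]
    exact hφ g v (K.down_closed hs (by simpa using hv) (Finset.singleton_nonempty v))
  · intro s hs x hx
    simp only [hf s hs x hx]
    have : φ '' (s : Set E) = A s '' (s : Set E) := Set.image_congr fun v hv => (hA s hs v hv).symm
    rw [this, ← AffineMap.image_convexHull]
    exact Set.mem_image_of_mem _ hx

end Extension

/-- A zero of the equivariant extension of the labelling lies in some simplex, and the value there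
is a convex combination of that simplex's labels. -/
theorem tuckerProperty_of_borsukUlamProperty (G : Type*) [Group G] [Fintype G]
    (h : BorsukUlamProperty G) : TuckerProperty G := by
  intro n hn K hK hinv φ _ hφ
  obtain ⟨f, hfc, hfe, hfK⟩ := exists_equivariant_extension _ (wPowRep G n) hK.finite hinv φ hφ
  rw [hK.space_eq] at hfc hfe
  obtain ⟨x, hx, hx0⟩ := h n hn f hfc hfe
  rw [← hK.space_eq] at hx
  obtain ⟨s, hs, hxs⟩ := SimplicialComplex.mem_space_iff.mp hx
  exact ⟨s, hs, hx0 ▸ hfK s hs x hxs⟩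

/-! ### Simplicial complexes from unique convex representations -/

section Unique

variable {E : Type*} [AddCommGroup E] [Module ℝ E]

/-- Every point has at most one representation as a convex combination of the points of a member
of `F`. -/
def HasUniqueWeights (F : Set (Finset E)) : Prop :=
  ∀ s ∈ F, ∀ t ∈ F, ∀ w u : E → ℝ, (∀ v, 0 ≤ w v) → (∀ v, 0 ≤ u v) →
    (∀ v ∉ s, w v = 0) → (∀ v ∉ t, u v = 0) → ∑ v ∈ s, w v = 1 → ∑ v ∈ t, u v = 1 →
    ∑ v ∈ s, w v • v = ∑ v ∈ t, u v • v → w = u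

/-- An affine dependency could be added to the barycentric weights of `s`, giving a second
representation of the same point. -/
theorem HasUniqueWeights.affineIndependent {F : Set (Finset E)} (hF : HasUniqueWeights F)
    {s : Finset E} (hs : s ∈ F) : AffineIndependent ℝ ((↑) : s → E) := by
  classical
  rw [affineIndependent_iff]
  intro r c hc0 hc e he
  -- extend the coefficients by zero to all of `E`
  set d : E → ℝ := fun v => if h : v ∈ s then (if ⟨v, h⟩ ∈ r then c ⟨v, h⟩ else 0) else 0 with hd
  have hd0 : ∑ v ∈ s, d v = 0 := by
    rw [← Finset.sum_coe_sort, ← hc0, ← Finset.sum_subset (Finset.subset_univ r)]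
    · exact Finset.sum_congr rfl fun v hv => by simp [hd, hv]
    · intro v _ hv; simp [hd, hv]
  have hdv : ∑ v ∈ s, d v • v = 0 := by
    rw [← Finset.sum_coe_sort, ← hc, ← Finset.sum_subset (Finset.subset_univ r)]
    · exact Finset.sum_congr rfl fun v hv => by simp [hd, hv]
    · intro v _ hv; simp [hd, hv]
  -- `C` bounds every `|d v|`, so the uniform weights perturbed by `d v / (s.card * C)` remain
  -- nonnegative.
  set C : ℝ := 1 + ∑ v ∈ s, |d v| with hC
  have hCpos : 0 < C := by positivity
  have hle : ∀ v ∈ s, |d v| ≤ C := fun v hv => by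
    have := Finset.single_le_sum (f := fun v => |d v|) (fun i _ => abs_nonneg _) hv
    linarith
  have hcard : (0 : ℝ) < s.card := by exact_mod_cast Finset.card_pos.mpr ⟨(e : E), e.2⟩
  have key := hF s hs s hs (fun v => if v ∈ s then (C + d v) / (s.card * C) else 0)
    (fun v => if v ∈ s then C / (s.card * C) else 0) ?_ ?_ ?_ ?_ ?_ ?_ ?_
  · have h1 := congrFun key e
    have h2 : (e : E) ∈ s := e.2
    simp only [h2, if_true] at h1
    rw [div_left_inj' (by positivity)] at h1
    have : d e = 0 := by linarith
    simpa [hd, he] using this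
  · intro v
    split_ifs with h
    · have := neg_abs_le (d v)
      have := hle v h
      exact div_nonneg (by linarith) (by positivity)
    · rfl
  · intro v; split_ifs <;> positivity
  · intro v hv; simp [hv]
  · intro v hv; simp [hv]
  · rw [Finset.sum_congr rfl fun v hv => if_pos hv, ← Finset.sum_div, Finset.sum_add_distrib, hd0]
    simp only [Finset.sum_const, nsmul_eq_mul, add_zero]
    exact div_self (by positivity)
  · rw [Finset.sum_congr rfl fun v hv => if_pos hv, ← Finset.sum_div]
    simp only [Finset.sum_const, nsmul_eq_mul]
    exact div_self (by positivity)
  · have h1 : ∀ v ∈ s, (if v ∈ s then (C + d v) / (s.card * C) else 0) • v =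
        (if v ∈ s then C / (s.card * C) else 0) • v + (1 / (s.card * C)) • d v • v := by
      intro v hv
      rw [if_pos hv, if_pos hv, smul_smul, ← add_smul]
      congr 1
      ring
    rw [Finset.sum_congr rfl h1, Finset.sum_add_distrib, ← Finset.smul_sum, hdv, smul_zero,
      add_zero]

/-- The weights of a common point with respect to `s` and to `t`, extended by zero, coincide and
therefore vanish off `s ∩ t`. -/
theorem HasUniqueWeights.inter_subset_convexHull {F : Set (Finset E)} (hF : HasUniqueWeights F)
    {s t : Finset E} (hs : s ∈ F) (ht : t ∈ F) :
    convexHull ℝ (s : Set E) ∩ convexHull ℝ (t : Set E) ⊆ convexHull ℝ (s ∩ t : Set E) := by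
  classical
  rintro x ⟨hxs, hxt⟩
  obtain ⟨w, hw0, hw1, hwx⟩ := Finset.mem_convexHull'.mp hxs
  obtain ⟨u, hu0, hu1, hux⟩ := Finset.mem_convexHull'.mp hxt
  have ext1 : ∀ (r : Finset E) (w : E → ℝ), ∑ v ∈ r, (if v ∈ r then w v else 0) = ∑ v ∈ r, w v :=
    fun r w => Finset.sum_congr rfl fun v hv => if_pos hv
  have ext2 : ∀ (r : Finset E) (w : E → ℝ),
      ∑ v ∈ r, (if v ∈ r then w v else 0) • v = ∑ v ∈ r, w v • v :=
    fun r w => Finset.sum_congr rfl fun v hv => by rw [if_pos hv]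
  have key := hF s hs t ht (fun v => if v ∈ s then w v else 0) (fun v => if v ∈ t then u v else 0)
    (fun v => by split_ifs with h; exacts [hw0 v h, le_rfl])
    (fun v => by split_ifs with h; exacts [hu0 v h, le_rfl])
    (fun v hv => if_neg hv) (fun v hv => if_neg hv) (by rw [ext1, hw1]) (by rw [ext1, hu1])
    (by rw [ext2, ext2, hwx, hux])
  have hzero : ∀ v ∈ s, v ∉ s ∩ t → w v = 0 := by
    intro v hv hvt
    have := congrFun key v
    simp only [hv, if_true] at this
    rw [this, if_neg fun h => hvt (Finset.mem_inter.mpr ⟨hv, h⟩)]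
  rw [← Finset.coe_inter, Finset.mem_convexHull']
  refine ⟨w, fun v hv => hw0 v (Finset.mem_inter.mp hv).1, ?_, ?_⟩
  · rw [Finset.sum_subset Finset.inter_subset_left hzero, hw1]
  · rw [Finset.sum_subset Finset.inter_subset_left fun v hv h => by rw [hzero v hv h, zero_smul],
      hwx]

end Unique

/-! ### The underlying space of the join -/

section JoinSpace

variable {G : Type*} [Fintype G] {M : ℕ}

/-- The coordinate description of the points of the `M`-fold join of `G`. -/
structure InJoin (x : G × Fin M → ℝ) : Prop where
  nonneg : ∀ p, 0 ≤ x p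
  sum_eq_one : ∑ p, x p = 1
  eq_of_ne_zero : ∀ g h i, x (g, i) ≠ 0 → x (h, i) ≠ 0 → g = h

theorem mem_convexHull_image_single_iff {ι : Type*} [Fintype ι] [DecidableEq ι] (c : Finset ι)
    (x : ι → ℝ) : x ∈ convexHull ℝ ((fun p => (Pi.single p 1 : ι → ℝ)) '' (c : Set ι)) ↔
      (∀ p, 0 ≤ x p) ∧ ∑ p, x p = 1 ∧ ∀ p ∉ c, x p = 0 := by
  constructor
  · intro hx
    have hconv : Convex ℝ {x : ι → ℝ | (∀ p, 0 ≤ x p) ∧ ∑ p, x p = 1 ∧ ∀ p ∉ c, x p = 0} := by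
      rintro x ⟨hx0, hx1, hxc⟩ y ⟨hy0, hy1, hyc⟩ a b ha hb hab
      refine ⟨fun p => ?_, ?_, fun p hp => ?_⟩
      · have := hx0 p
        have := hy0 p
        simp only [Pi.add_apply, Pi.smul_apply, smul_eq_mul]
        positivity
      · simp [Finset.sum_add_distrib, ← Finset.mul_sum, hx1, hy1, hab]
      · simp [hxc p hp, hyc p hp]
    refine convexHull_min ?_ hconv hx
    rintro _ ⟨q, hq, rfl⟩
    refine ⟨fun p => ?_, by simp, fun p hp => ?_⟩
    · by_cases h : p = q
      · subst h; simp
      · simp [Pi.single_eq_of_ne h]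
    · have h : p ≠ q := by rintro rfl; exact hp hq
      exact Pi.single_eq_of_ne h _
  · rintro ⟨hx0, hx1, hxc⟩
    have h1 : ∑ p ∈ c, x p = 1 := by
      rw [← hx1]
      exact Finset.sum_subset (Finset.subset_univ c) fun p _ hp => hxc p hp
    have h2 : ∑ p ∈ c, x p • (Pi.single p 1 : ι → ℝ) = x := by
      rw [Finset.sum_subset (Finset.subset_univ c) fun p _ hp => by rw [hxc p hp, zero_smul]]
      ext q
      simp [Finset.sum_apply, Pi.single_apply]
    rw [← h2]
    exact (convex_convexHull ℝ _).sum_mem (fun p _ => hx0 p) h1 fun p hp =>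
      subset_convexHull ℝ _ ⟨p, hp, rfl⟩

theorem exists_of_mem_joinComplex_faces {G : Type*} {M : ℕ} [Group G] [DecidableEq (G × Fin M)]
    {s : Finset (G × Fin M → ℝ)} (hs : s ∈ (joinComplex G M).faces) :
    ∃ c : Finset (G × Fin M), Set.InjOn Prod.snd (c : Set (G × Fin M)) ∧
      (s : Set (G × Fin M → ℝ)) = (fun p => Pi.single p 1) '' (c : Set (G × Fin M)) := by
  obtain ⟨c, _, hc, rfl⟩ := hs
  refine ⟨c, hc, ?_⟩
  refine (@Finset.coe_image _ _ (Classical.decEq _) _ _).trans ?_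
  congr!

/-- The points in the support of `x` span a simplex of the join. -/
theorem InJoin.exists_mem_faces [Group G] [DecidableEq (G × Fin M)] {x : G × Fin M → ℝ}
    (hx : InJoin x) : ∃ c : Finset (G × Fin M), (∀ p, p ∈ c ↔ x p ≠ 0) ∧
      ∃ s ∈ (joinComplex G M).faces,
        (s : Set (G × Fin M → ℝ)) = (fun p => Pi.single p 1) '' (c : Set (G × Fin M)) := by
  refine ⟨Finset.univ.filter fun p => x p ≠ 0, by simp, _, ⟨Finset.univ.filter fun p => x p ≠ 0,
    ?_, ?_, rfl⟩, ?_⟩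
  · by_contra h
    rw [Finset.not_nonempty_iff_eq_empty] at h
    have h0 : ∀ p, x p = 0 := fun p => by
      have : p ∉ Finset.univ.filter fun p => x p ≠ 0 := by simp [h]
      simpa using this
    have := hx.sum_eq_one
    simp [h0] at this
  · rintro ⟨g, i⟩ hp ⟨h, j⟩ hq hij
    simp only [Finset.coe_filter, Finset.mem_univ, true_and, Set.mem_ofPred_eq] at hp hq hij
    subst hij
    rw [hx.eq_of_ne_zero g h i hp hq]
  · refine (@Finset.coe_image _ _ (Classical.decEq _) _ _).trans ?_
    congr!

theorem mem_joinComplex_space_iff [Group G] (x : G × Fin M → ℝ) :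
    x ∈ (joinComplex G M).space ↔ InJoin x := by
  classical
  rw [SimplicialComplex.mem_space_iff]
  constructor
  · rintro ⟨s, hs, hx⟩
    obtain ⟨c, hc, hsc⟩ := exists_of_mem_joinComplex_faces hs
    rw [hsc, mem_convexHull_image_single_iff] at hx
    obtain ⟨h0, h1, h2⟩ := hx
    refine ⟨h0, h1, fun g h i hg hh => ?_⟩
    have hg' : (g, i) ∈ c := by by_contra H; exact hg (h2 _ H)
    have hh' : (h, i) ∈ c := by by_contra H; exact hh (h2 _ H)
    exact congrArg Prod.fst (hc (Finset.mem_coe.mpr hg') (Finset.mem_coe.mpr hh') rfl)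
  · intro hx
    obtain ⟨c, hc, s, hs, hsc⟩ := hx.exists_mem_faces
    refine ⟨s, hs, ?_⟩
    rw [hsc, mem_convexHull_image_single_iff]
    exact ⟨hx.nonneg, hx.sum_eq_one, fun p hp => by simpa [hc] using hp⟩

theorem isCompact_joinComplex_space (G : Type*) [Fintype G] [Group G] (M : ℕ) :
    IsCompact (joinComplex G M).space := by
  classical
  have hfin : (joinComplex G M).faces.Finite := by
    refine Set.Finite.of_finite_image (f := fun s : Finset (G × Fin M → ℝ) => (s : Set _))
      ((Set.finite_range fun c : Finset (G × Fin M) =>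
        (fun p => (Pi.single p 1 : G × Fin M → ℝ)) '' (c : Set (G × Fin M))).subset ?_)
      Finset.coe_injective.injOn
    rintro _ ⟨s, hs, rfl⟩
    obtain ⟨c, _, hsc⟩ := exists_of_mem_joinComplex_faces hs
    exact ⟨c, hsc.symm⟩
  exact hfin.isCompact_biUnion fun s _ => s.finite_toSet.isCompact_convexHull ℝ

/-- The sum of the coordinates of `x` in the first `i` copies of `G`. -/
noncomputable def partialSum (i : ℕ) : (G × Fin M → ℝ) →ₗ[ℝ] ℝ :=
  ∑ p : G × Fin M with (p.2 : ℕ) < i, LinearMap.proj p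

theorem partialSum_apply (i : ℕ) (x : G × Fin M → ℝ) :
    partialSum i x = ∑ p : G × Fin M with (p.2 : ℕ) < i, x p := by
  simp [partialSum]

theorem partialSum_zero (x : G × Fin M → ℝ) : partialSum 0 x = 0 := by
  simp [partialSum_apply]

theorem partialSum_last (x : G × Fin M → ℝ) : partialSum M x = ∑ p, x p := by
  simp [partialSum_apply]

theorem partialSum_succ (i : Fin M) (x : G × Fin M → ℝ) :
    partialSum (i + 1) x = partialSum i x + ∑ h, x (h, i) := by
  simp only [partialSum_apply, Finset.sum_filter, Fintype.sum_prod_type]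
  rw [← Finset.sum_add_distrib]
  refine Finset.sum_congr rfl fun g _ => ?_
  have : x (g, i) = ∑ j, if j = i then x (g, j) else 0 := by simp
  rw [this, ← Finset.sum_add_distrib]
  refine Finset.sum_congr rfl fun j _ => ?_
  rcases lt_trichotomy j i with h | h | h
  · have h' : (j : ℕ) < i := h
    simp [h', h.ne, h'.trans (Nat.lt_succ_self _)]
  · subst h; simp
  · have h' : (i : ℕ) < j := h
    simp [h.ne', not_lt.mpr h'.le, not_le.mpr h]

theorem sum_comp_eq_comp_sum {F : ℝ → ℝ} (hF : F 0 = 0) {x : G → ℝ}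
    (hx : ∀ g h, x g ≠ 0 → x h ≠ 0 → g = h) : ∑ g, F (x g) = F (∑ g, x g) := by
  by_cases h : ∃ g, x g ≠ 0
  · obtain ⟨g, hg⟩ := h
    have h0 : ∀ h, h ≠ g → x h = 0 := fun h hh => by
      by_contra H; exact hh (hx h g H hg)
    rw [Fintype.sum_eq_single g fun h hh => by rw [h0 h hh, hF], Fintype.sum_eq_single g h0]
  · push Not at h
    simp [h, hF]

end JoinSpace

/-! ### Grid points -/

section Grid

variable {G : Type*} [Fintype G] {M : ℕ}

/-- The point with coordinates in `(1 / m) ℤ` that is obtained from `x` by rounding the partial sums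
of its coordinates, each shifted by `θ`. -/
noncomputable def gridPoint (m : ℕ) (θ : ℝ) (x : G × Fin M → ℝ) : G × Fin M → ℝ := fun p =>
  ((⌊m * (partialSum p.2 x + x p) + θ⌋ : ℝ) - ⌊m * partialSum p.2 x + θ⌋) / m

theorem gridPoint_eq_zero (m : ℕ) (θ : ℝ) {x : G × Fin M → ℝ} {p : G × Fin M} (hp : x p = 0) :
    gridPoint m θ x p = 0 := by
  simp [gridPoint, hp]

theorem gridPoint_nonneg (m : ℕ) (θ : ℝ) {x : G × Fin M → ℝ} (hx : ∀ p, 0 ≤ x p) (p : G × Fin M) :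
    0 ≤ gridPoint m θ x p := by
  refine div_nonneg (sub_nonneg.mpr ?_) m.cast_nonneg
  have := hx p
  exact_mod_cast Int.floor_le_floor (by gcongr; linarith)

theorem abs_gridPoint_sub_le {m : ℕ} (hm : 0 < m) (θ : ℝ) (x : G × Fin M → ℝ) (p : G × Fin M) :
    |gridPoint m θ x p - x p| ≤ 1 / m := by
  have hm' : (0 : ℝ) < m := by exact_mod_cast hm
  have key : gridPoint m θ x p - x p =
      ((⌊m * (partialSum p.2 x + x p) + θ⌋ : ℝ) - ⌊m * partialSum p.2 x + θ⌋ - m * x p) / m := by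
    rw [gridPoint]; field_simp
  rw [key, abs_div, abs_of_pos hm']
  gcongr
  have h1 := Int.floor_le (m * (partialSum p.2 x + x p) + θ)
  have h2 := Int.lt_floor_add_one (m * (partialSum p.2 x + x p) + θ)
  have h3 := Int.floor_le (m * partialSum p.2 x + θ)
  have h4 := Int.lt_floor_add_one (m * partialSum p.2 x + θ)
  rw [abs_le]
  constructor <;> linarith

/-- Each copy of `G` carries at most one nonzero coordinate, so its rounded coordinates add up to a
difference of two consecutive floors, and these telescope. The sum starts at `⌊θ⌋ = 0`, since `θ ∈
[0, 1)`. -/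
theorem InJoin.partialSum_gridPoint {x : G × Fin M → ℝ} (hx : InJoin x) {m : ℕ} (hm : 0 < m)
    {θ : ℝ} (hθ : θ ∈ Set.Ico (0 : ℝ) 1) {i : ℕ} (hi : i ≤ M) :
    m * partialSum i (gridPoint m θ x) = ⌊m * partialSum i x + θ⌋ := by
  have hm' : (m : ℝ) ≠ 0 := by exact_mod_cast hm.ne'
  induction i with
  | zero =>
    have : ⌊θ⌋ = 0 := Int.floor_eq_zero_iff.mpr hθ
    simp [partialSum_zero, this]
  | succ i ih =>
    specialize ih (by omega)
    rw [partialSum_succ ⟨i, hi⟩, partialSum_succ ⟨i, hi⟩]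
    simp only
    rw [mul_add, ih]
    have h := sum_comp_eq_comp_sum
      (F := fun y => ((⌊m * (partialSum i x + y) + θ⌋ : ℝ) - ⌊m * partialSum i x + θ⌋) / m)
      (by simp) (x := fun g => x (g, ⟨i, hi⟩)) fun g h => hx.eq_of_ne_zero g h _
    simp only [gridPoint]
    rw [h]
    field_simp
    ring

theorem InJoin.gridPoint {x : G × Fin M → ℝ} (hx : InJoin x) {m : ℕ} (hm : 0 < m)
    {θ : ℝ} (hθ : θ ∈ Set.Ico (0 : ℝ) 1) : InJoin (gridPoint m θ x) := by
  have hm' : (m : ℝ) ≠ 0 := by exact_mod_cast hm.ne'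
  refine ⟨gridPoint_nonneg m θ hx.nonneg, ?_, fun g h i hg hh => hx.eq_of_ne_zero g h i
    (mt (gridPoint_eq_zero m θ) hg) (mt (gridPoint_eq_zero m θ) hh)⟩
  have h := hx.partialSum_gridPoint hm hθ le_rfl
  rw [partialSum_last, partialSum_last, hx.sum_eq_one, mul_one] at h
  have h2 : ⌊(m : ℝ) + θ⌋ = m := by
    rw [Int.floor_eq_iff]
    exact ⟨by simpa using hθ.1, by simpa using hθ.2⟩
  rw [h2, Int.cast_natCast] at h
  exact (mul_eq_left₀ hm').mp h

theorem finite_range_gridPoint (m : ℕ) : {v : G × Fin M → ℝ | ∃ x, InJoin x ∧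
    ∃ θ ∈ Set.Ico (0 : ℝ) 1, v = gridPoint m θ x}.Finite := by
  -- For `m = 0` division by zero makes every grid point 0.
  rcases m.eq_zero_or_pos with rfl | hm
  · refine (Set.finite_singleton 0).subset ?_
    rintro _ ⟨x, _, θ, _, rfl⟩
    ext p
    simp [gridPoint]
  have hm' : (0 : ℝ) < m := by exact_mod_cast hm
  have hfin : (Set.range fun j : Fin (m + 1) => (j : ℝ) / m).Finite := Set.finite_range _
  refine (Set.Finite.pi' fun _ : G × Fin M => hfin).subset ?_
  rintro _ ⟨x, hx, θ, hθ, rfl⟩ p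
  have hv := hx.gridPoint hm hθ
  have h0 := hv.nonneg p
  have h1 : gridPoint m θ x p ≤ 1 := by
    rw [← hv.sum_eq_one]
    exact Finset.single_le_sum (fun q _ => hv.nonneg q) (Finset.mem_univ p)
  set z : ℤ := ⌊m * (partialSum p.2 x + x p) + θ⌋ - ⌊m * partialSum p.2 x + θ⌋ with hz
  have hvz : gridPoint m θ x p = z / m := by simp [gridPoint, hz]
  rw [hvz] at h0 h1 ⊢
  rw [div_le_one hm'] at h1
  have hz0 : 0 ≤ z := by
    by_contra H
    push Not at H
    have : (z : ℝ) < 0 := by exact_mod_cast H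
    exact absurd h0 (not_le.mpr (div_neg_of_neg_of_pos this hm'))
  have hz1 : z ≤ m := by exact_mod_cast h1
  refine ⟨⟨z.toNat, by omega⟩, ?_⟩
  have : ((z.toNat : ℤ) : ℝ) = z := by rw [Int.toNat_of_nonneg hz0]
  simp only
  rw [← this, Int.cast_natCast]

end Grid

/-! ### The grid subdivision of the join -/

section GridComplex

/-- For a distribution `w` on two consecutive integers, the mass of the values that are at least `c`
is determined by the mean. -/
theorem sum_ite_le_eq_clamp {α : Type*} {s : Finset α} {w : α → ℝ} (hw0 : ∀ v ∈ s, 0 ≤ w v)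
    (hw1 : ∑ v ∈ s, w v = 1) {L : α → ℤ} {n : ℤ} (hL : ∀ v ∈ s, n ≤ L v ∧ L v ≤ n + 1) (c : ℤ) :
    ∑ v ∈ s, (if c ≤ L v then w v else 0) =
      max 0 (min 1 (∑ v ∈ s, w v * L v - c + 1)) := by
  have hlow : (n : ℝ) ≤ ∑ v ∈ s, w v * L v := by
    calc (n : ℝ) = ∑ v ∈ s, w v * n := by rw [← Finset.sum_mul, hw1, one_mul]
      _ ≤ _ := Finset.sum_le_sum fun v hv =>
        mul_le_mul_of_nonneg_left (by exact_mod_cast (hL v hv).1) (hw0 v hv)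
  have hup : ∑ v ∈ s, w v * L v ≤ (n : ℝ) + 1 := by
    calc _ ≤ ∑ v ∈ s, w v * ((n : ℝ) + 1) := Finset.sum_le_sum fun v hv =>
          mul_le_mul_of_nonneg_left (by exact_mod_cast (hL v hv).2) (hw0 v hv)
      _ = _ := by rw [← Finset.sum_mul, hw1, one_mul]
  -- The values are `n` or `n + 1`: the mass is 1 for `c ≤ n`, the mean minus `n` for `c = n + 1`,
  -- and 0 beyond.
  rcases lt_trichotomy c (n + 1) with h | h | h
  · have hc : (c : ℝ) ≤ n := by exact_mod_cast Int.lt_add_one_iff.mp h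
    rw [min_eq_left (by linarith), max_eq_right zero_le_one, ← hw1]
    refine Finset.sum_congr rfl fun v hv => if_pos ?_
    have := (hL v hv).1
    omega
  · subst h
    have : ∑ v ∈ s, (if n + 1 ≤ L v then w v else 0) = ∑ v ∈ s, w v * L v - n := by
      have hn : (n : ℝ) = ∑ v ∈ s, w v * n := by rw [← Finset.sum_mul, hw1, one_mul]
      rw [hn, ← Finset.sum_sub_distrib]
      refine Finset.sum_congr rfl fun v hv => ?_
      have h2 := hL v hv
      split_ifs with h3
      · have h4 : L v = n + 1 := le_antisymm h2.2 h3
        rw [h4]; push_cast; ring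
      · have h4 : L v = n := by omega
        rw [h4]; ring
    rw [this]
    push_cast
    rw [min_eq_right (by linarith), max_eq_right (by linarith)]
    ring
  · have hc : (n : ℝ) + 1 + 1 ≤ c := by exact_mod_cast h
    rw [max_eq_left ((min_le_right _ _).trans (by linarith))]
    refine Finset.sum_eq_zero fun v hv => if_neg ?_
    have := (hL v hv).2
    omega

variable {G : Type*} [Fintype G] {M : ℕ}

variable (G M) in
/-- The simplices of the grid subdivision: the sets of roundings of a common point. -/
def gridFaces (m : ℕ) : Set (Finset (G × Fin M → ℝ)) :=
  {s | s.Nonempty ∧ ∃ y, InJoin y ∧ ∀ v ∈ s, ∃ θ ∈ Set.Ico (0 : ℝ) 1, v = gridPoint m θ y}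

open Classical in
/-- The upper distribution function of a convex combination of the vertices of a grid simplex
depends only on the point that it represents. -/
theorem isLeast_sum_ite_le {m : ℕ} (hm : 0 < m) {s : Finset (G × Fin M → ℝ)}
    (hs : s ∈ gridFaces G M m) {w : (G × Fin M → ℝ) → ℝ} (hw0 : ∀ v, 0 ≤ w v)
    (hw1 : ∑ v ∈ s, w v = 1) (c : ℕ → ℤ) :
    IsLeast ((fun i => max 0 (min 1 (m * partialSum i (∑ v ∈ s, w v • v) - c i + 1))) ''
        (Finset.range (M + 1) : Set ℕ))
      (∑ v ∈ s, if ∀ i ∈ Finset.range (M + 1), c i ≤ ⌊m * partialSum i v⌋ then w v else 0) := by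
  obtain ⟨_, y, hy, hsy⟩ := hs
  choose! θ hθ hv using hsy
  have hL : ∀ v ∈ s, ∀ i ∈ Finset.range (M + 1),
      m * partialSum i v = ⌊m * partialSum i y + θ v⌋ := fun v hvs i hi => by
    have := hy.partialSum_gridPoint hm (hθ v hvs) (Finset.mem_range_succ_iff.mp hi)
    rwa [← hv v hvs] at this
  have hfl : ∀ v ∈ s, ∀ i ∈ Finset.range (M + 1),
      ⌊m * partialSum i v⌋ = ⌊m * partialSum i y + θ v⌋ := fun v hvs i hi => by
    rw [hL v hvs i hi, Int.floor_intCast]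
  have hclamp : ∀ i ∈ Finset.range (M + 1),
      ∑ v ∈ s, (if c i ≤ ⌊m * partialSum i v⌋ then w v else 0) =
        max 0 (min 1 (m * partialSum i (∑ v ∈ s, w v • v) - c i + 1)) := by
    intro i hi
    rw [sum_ite_le_eq_clamp (fun v _ => hw0 v) hw1 (n := ⌊m * partialSum i y⌋)]
    · congr 4
      rw [map_sum, Finset.mul_sum]
      refine Finset.sum_congr rfl fun v hvs => ?_
      rw [hfl v hvs i hi, ← hL v hvs i hi, map_smul, smul_eq_mul]
      ring
    · intro v hvs
      rw [hfl v hvs i hi]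
      have h1 := hθ v hvs
      refine ⟨Int.floor_le_floor (by linarith [h1.1]), ?_⟩
      rw [← Int.floor_add_one]
      exact Int.floor_le_floor (by linarith [h1.2])
  constructor
  -- The condition at `i` says `c i - m * partialSum i y ≤ θ v`. The index with the largest left
  -- side implies all the others, so the minimum is attained there.
  · obtain ⟨i, hi, hmax⟩ := Finset.exists_max_image (Finset.range (M + 1))
      (fun i => c i - m * partialSum i y) ⟨0, by simp⟩
    refine ⟨i, hi, ?_⟩
    simp only
    rw [← hclamp i hi]
    refine Finset.sum_congr rfl fun v hvs => ?_
    by_cases h : c i ≤ ⌊m * partialSum i v⌋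
    · rw [if_pos h, if_pos fun j hj => ?_]
      rw [hfl v hvs i hi, Int.le_floor] at h
      rw [hfl v hvs j hj, Int.le_floor]
      have := hmax j hj
      linarith
    · rw [if_neg h, if_neg fun H => h (H i hi)]
  · rintro _ ⟨i, hi, rfl⟩
    simp only
    rw [← hclamp i hi]
    refine Finset.sum_le_sum fun v _ => ?_
    split_ifs with h1 h2 h2
    · exact le_rfl
    · exact absurd (h1 i hi) h2
    · exact hw0 v
    · exact le_rfl

theorem InJoin.sum_smul {y : G × Fin M → ℝ} (hy : InJoin y) {s : Finset (G × Fin M → ℝ)}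
    (hs : ∀ v ∈ s, InJoin v ∧ ∀ p, y p = 0 → v p = 0) {w : (G × Fin M → ℝ) → ℝ}
    (hw0 : ∀ v, 0 ≤ w v) (hw1 : ∑ v ∈ s, w v = 1) : InJoin (∑ v ∈ s, w v • v) := by
  refine ⟨fun p => ?_, ?_, fun g h i hg hh => ?_⟩
  · rw [Finset.sum_apply]
    exact Finset.sum_nonneg fun v hv => mul_nonneg (hw0 v) ((hs v hv).1.nonneg p)
  · simp only [Finset.sum_apply, Pi.smul_apply, smul_eq_mul]
    rw [Finset.sum_comm, ← hw1]
    exact Finset.sum_congr rfl fun v hv => by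
      rw [← Finset.mul_sum, (hs v hv).1.sum_eq_one, mul_one]
  · have h0 : ∀ p, (∑ v ∈ s, w v • v) p ≠ 0 → y p ≠ 0 := fun p hp hyp => hp <| by
      rw [Finset.sum_apply]
      exact Finset.sum_eq_zero fun v hv => by simp [(hs v hv).2 p hyp]
    exact hy.eq_of_ne_zero g h i (h0 _ hg) (h0 _ hh)

theorem eq_zero_of_sum_smul_eq_zero {ι : Type*} {s : Finset (ι → ℝ)}
    (hs : ∀ v ∈ s, ∀ p, 0 ≤ v p) {w : (ι → ℝ) → ℝ} (hw0 : ∀ v, 0 ≤ w v) {v : ι → ℝ} (hv : v ∈ s)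
    (hwv : w v ≠ 0) {p : ι} (hp : (∑ v ∈ s, w v • v) p = 0) : v p = 0 := by
  rw [Finset.sum_apply, Finset.sum_eq_zero_iff_of_nonneg] at hp
  · have := hp v hv
    simpa [hwv] using this
  · exact fun v hv => mul_nonneg (hw0 v) (hs v hv p)

/-- Where the support of `x` meets a copy of `G`, it does so in a single element, and the coordinate
of `v` there is the increment of its partial sums. -/
theorem InJoin.eq_of_partialSum_eq {x v v' : G × Fin M → ℝ} (hx : InJoin x)
    (h : ∀ p, x p = 0 → v p = 0) (h' : ∀ p, x p = 0 → v' p = 0)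
    (heq : ∀ i ≤ M, partialSum i v = partialSum i v') : v = v' := by
  have key : ∀ u : G × Fin M → ℝ, (∀ p, x p = 0 → u p = 0) → ∀ g i, x (g, i) ≠ 0 →
      partialSum (i + 1) u = partialSum i u + u (g, i) := by
    intro u hu g i hg
    rw [partialSum_succ, Fintype.sum_eq_single g fun k hk => hu _ ?_]
    by_contra H
    exact hk (hx.eq_of_ne_zero k g i H hg)
  ext ⟨g, i⟩
  by_cases hg : x (g, i) = 0
  · rw [h _ hg, h' _ hg]
  · have h1 := key v h g i hg
    have h2 := key v' h' g i hg
    rw [heq _ i.2, heq _ i.2.le, h2] at h1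
    linarith

/-- By `isLeast_sum_ite_le`, the mass of the vertices lying above given thresholds depends only on
the represented point. Comparing `w` and `u` at a highest vertex where they differ then isolates
that vertex. -/
theorem hasUniqueWeights_gridFaces {m : ℕ} (hm : 0 < m) : HasUniqueWeights (gridFaces G M m) := by
  classical
  intro s hs t ht w u hw0 hu0 hws hut hw1 hu1 hx
  have hm' : (0 : ℝ) < m := by exact_mod_cast hm
  have hInt : ∀ r ∈ gridFaces G M m, ∀ v ∈ r, ∀ i ∈ Finset.range (M + 1),
      (⌊m * partialSum i v⌋ : ℝ) = m * partialSum i v := by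
    rintro r ⟨_, y, hy, hry⟩ v hv i hi
    obtain ⟨θ, hθ, rfl⟩ := hry v hv
    rw [hy.partialSum_gridPoint hm hθ (Finset.mem_range_succ_iff.mp hi), Int.floor_intCast]
  have hJ : ∀ r ∈ gridFaces G M m, ∀ v ∈ r, InJoin v := by
    rintro r ⟨_, y, hy, hry⟩ v hv
    obtain ⟨θ, hθ, rfl⟩ := hry v hv
    exact hy.gridPoint hm hθ
  have hxJ : InJoin (∑ v ∈ s, w v • v) := by
    obtain ⟨_, y, hy, hsy⟩ := hs
    refine hy.sum_smul (fun v hv => ?_) hw0 hw1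
    obtain ⟨θ, hθ, rfl⟩ := hsy v hv
    exact ⟨hy.gridPoint hm hθ, fun p hp => gridPoint_eq_zero m θ hp⟩
  set D := (s ∪ t).filter fun v => w v ≠ u v with hD
  have hsupp : ∀ v ∈ D, ∀ p, (∑ v ∈ s, w v • v) p = 0 → v p = 0 := by
    intro v hv p hp
    have hne := (Finset.mem_filter.mp hv).2
    by_cases hwv : w v = 0
    · have huv : u v ≠ 0 := fun h => hne (hwv.trans h.symm)
      have hvt : v ∈ t := by by_contra H; exact huv (hut v H)
      exact eq_zero_of_sum_smul_eq_zero (fun v hv => (hJ t ht v hv).nonneg) hu0 hvt huv (hx ▸ hp)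
    · have hvs : v ∈ s := by by_contra H; exact hwv (hws v H)
      exact eq_zero_of_sum_smul_eq_zero (fun v hv => (hJ s hs v hv).nonneg) hw0 hvs hwv hp
  have hDmem : ∀ v ∈ D, ∃ r ∈ gridFaces G M m, v ∈ r := by
    intro v hv
    rcases Finset.mem_union.mp (Finset.mem_filter.mp hv).1 with h | h
    exacts [⟨s, hs, h⟩, ⟨t, ht, h⟩]
  by_contra hwu
  have hDne : D.Nonempty := by
    obtain ⟨v, hv⟩ := Function.ne_iff.mp hwu
    refine ⟨v, Finset.mem_filter.mpr ⟨?_, hv⟩⟩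
    by_contra H
    rw [Finset.mem_union, not_or] at H
    exact hv ((hws v H.1).trans (hut v H.2).symm)
  -- With the partial sums of `v` as thresholds, any other vertex above `v` at which `w` and `u`
  -- differ would have the same total by maximality, hence the same partial sums, and would equal
  -- `v`.
  obtain ⟨v, hvD, hvmax⟩ := Finset.exists_max_image D
    (fun v => ∑ i ∈ Finset.range (M + 1), ⌊m * partialSum i v⌋) hDne
  have h1 := isLeast_sum_ite_le hm hs hw0 hw1 fun i => ⌊m * partialSum i v⌋
  have h2 := isLeast_sum_ite_le hm ht hu0 hu1 fun i => ⌊m * partialSum i v⌋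
  rw [← hx] at h2
  have h3 := h1.unique h2
  rw [Finset.sum_subset (s₁ := s) (s₂ := s ∪ t) Finset.subset_union_left
      fun v _ hv => by simp [hws v hv],
    Finset.sum_subset (s₁ := t) (s₂ := s ∪ t) Finset.subset_union_right
      fun v _ hv => by simp [hut v hv], ← sub_eq_zero, ← Finset.sum_sub_distrib, Finset.sum_eq_single_of_mem v] at h3
  · simp only [le_refl, implies_true, if_true] at h3
    exact (Finset.mem_filter.mp hvD).2 (sub_eq_zero.mp h3)
  · exact (Finset.mem_filter.mp hvD).1
  · intro v' hv' hne
    split_ifs with hle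
    · rw [sub_eq_zero]
      by_contra hwu'
      have hv'D : v' ∈ D := Finset.mem_filter.mpr ⟨hv', hwu'⟩
      have hmax := hvmax v' hv'D
      have heq := (Finset.sum_eq_sum_iff_of_le hle).mp
        (le_antisymm (Finset.sum_le_sum hle) hmax)
      obtain ⟨r, hr, hvr⟩ := hDmem v hvD
      obtain ⟨r', hr', hvr'⟩ := hDmem v' hv'D
      refine hne (hxJ.eq_of_partialSum_eq (hsupp v' hv'D)
        (hsupp v hvD) fun i hi => ?_)
      have hi' := Finset.mem_range_succ_iff.mpr hi
      have h4 : (⌊m * partialSum i v⌋ : ℝ) = ⌊m * partialSum i v'⌋ := by rw [heq i hi']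
      rw [hInt r hr v hvr i hi', hInt r' hr' v' hvr' i hi'] at h4
      exact (mul_left_cancel₀ hm'.ne' h4).symm
    · simp

variable (G M) in
/-- The subdivision of the join by grid points. -/
noncomputable def gridComplex {m : ℕ} (hm : 0 < m) : SimplicialComplex ℝ (G × Fin M → ℝ) where
  faces := gridFaces G M m
  isRelLowerSet_faces := fun _ ⟨hne, y, hy, h⟩ =>
    ⟨hne, fun _ hts ht => ⟨ht, y, hy, fun v hv => h v (hts hv)⟩⟩
  indep hs := (hasUniqueWeights_gridFaces hm).affineIndependent hs
  inter_subset_convexHull hs ht := (hasUniqueWeights_gridFaces hm).inter_subset_convexHull hs ht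

/-! ### Averaging the roundings over the shift -/

open MeasureTheory in
theorem integrable_floor_add (a : ℝ) :
    Integrable (fun θ : ℝ => (⌊a + θ⌋ : ℝ)) (volume.restrict (Set.Ico 0 1)) := by
  have hmono : Monotone fun θ : ℝ => (⌊a + θ⌋ : ℝ) := fun x y hxy => by
    have : ⌊a + x⌋ ≤ ⌊a + y⌋ := Int.floor_le_floor (by linarith)
    simpa using this
  exact ((hmono.monotoneOn _).integrableOn_isCompact isCompact_Icc).mono_set Set.Ico_subset_Icc_self

-- On `[0, 1)` the integrand is `⌊a⌋`, and one more from `1 - Int.fract a` on, an interval of length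
-- `Int.fract a`.
open MeasureTheory in
theorem integral_floor_add (a : ℝ) : ∫ θ in Set.Ico (0 : ℝ) 1, (⌊a + θ⌋ : ℝ) = a := by
  have h : ∀ θ ∈ Set.Ico (0 : ℝ) 1,
      (⌊a + θ⌋ : ℝ) = ⌊a⌋ + (Set.Ici (1 - Int.fract a)).indicator 1 θ := by
    intro θ hθ
    have h0 := Int.floor_add_fract a
    have h1 := Int.fract_nonneg a
    have h2 := Int.fract_lt_one a
    by_cases hc : 1 - Int.fract a ≤ θ
    · rw [Set.indicator_of_mem (Set.mem_Ici.mpr hc), Pi.one_apply]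
      have : ⌊a + θ⌋ = ⌊a⌋ + 1 := by
        rw [Int.floor_eq_iff]
        push_cast
        constructor <;> linarith [hθ.2]
      rw [this]; push_cast; ring
    · rw [Set.indicator_of_notMem (by simpa using hc), add_zero]
      push Not at hc
      have : ⌊a + θ⌋ = ⌊a⌋ := by
        rw [Int.floor_eq_iff]
        constructor <;> linarith [hθ.1]
      rw [this]
  rw [setIntegral_congr_fun measurableSet_Ico h, integral_add]
  · rw [integral_indicator_one measurableSet_Ici]
    have h1 := Int.fract_nonneg a
    have h2 := Int.fract_lt_one a
    have : Set.Ici (1 - Int.fract a) ∩ Set.Ico 0 1 = Set.Ico (1 - Int.fract a) 1 := by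
      ext θ
      simp only [Set.mem_inter_iff, Set.mem_Ici, Set.mem_Ico]
      constructor
      · exact fun h => ⟨h.1, h.2.2⟩
      · exact fun h => ⟨h.1, by linarith [h.1], h.2⟩
    rw [measureReal_restrict_apply measurableSet_Ici, this]
    simp only [integral_const, Real.volume_real_Ico, measureReal_restrict_apply_univ]
    rw [max_eq_left (by linarith), max_eq_left (by linarith)]
    have h0 := Int.floor_add_fract a
    simp only [smul_eq_mul]
    linarith
  · exact integrable_const _
  · exact (integrable_const (1 : ℝ)).indicator measurableSet_Ici

-- The mean of the roundings over uniform `θ` is `x`. There are finitely many roundings, so their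
-- hull is closed and contains this mean.
open MeasureTheory in
theorem mem_convexHull_range_gridPoint {m : ℕ} (hm : 0 < m) {x : G × Fin M → ℝ} (hx : InJoin x) :
    x ∈ convexHull ℝ ((fun θ => gridPoint m θ x) '' Set.Ico (0 : ℝ) 1) := by
  have hm' : (m : ℝ) ≠ 0 := by exact_mod_cast hm.ne'
  have hfin : ((fun θ => gridPoint m θ x) '' Set.Ico (0 : ℝ) 1).Finite := by
    refine (finite_range_gridPoint m).subset ?_
    rintro _ ⟨θ, hθ, rfl⟩
    exact ⟨x, hx, θ, hθ, rfl⟩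
  have hint : ∀ p, Integrable (fun θ => gridPoint m θ x p) (volume.restrict (Set.Ico (0 : ℝ) 1)) :=
    fun p => ((integrable_floor_add _).sub (integrable_floor_add _)).div_const _
  have hprob : IsProbabilityMeasure (volume.restrict (Set.Ico (0 : ℝ) 1)) := ⟨by simp⟩
  have key := (convex_convexHull ℝ _).integral_mem (hfin.isClosed_convexHull ℝ)
    (μ := volume.restrict (Set.Ico (0 : ℝ) 1)) (f := fun θ => gridPoint m θ x)
    ((ae_restrict_iff' measurableSet_Ico).mpr (.of_forall fun θ hθ =>
      subset_convexHull ℝ _ ⟨θ, hθ, rfl⟩)) (Integrable.of_eval hint)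
  convert key
  ext p
  rw [eval_integral hint]
  simp only [gridPoint]
  rw [integral_div, integral_sub (integrable_floor_add _) (integrable_floor_add _),
    integral_floor_add, integral_floor_add]
  field_simp
  ring

variable [Group G]

theorem isSubdivision_gridComplex {m : ℕ} (hm : 0 < m) :
    IsSubdivision (gridComplex G M hm) (joinComplex G M) := by
  classical
  have href : ∀ s ∈ (gridComplex G M hm).faces, ∃ t ∈ (joinComplex G M).faces,
      convexHull ℝ (s : Set (G × Fin M → ℝ)) ⊆ convexHull ℝ (t : Set (G × Fin M → ℝ)) := by
    rintro s ⟨_, y, hy, hsy⟩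
    -- Rounding keeps zero coordinates zero, so all roundings of `y` lie in the simplex spanned by
    -- the support of `y`.
    obtain ⟨c, hc, t, ht, htc⟩ := hy.exists_mem_faces
    refine ⟨t, ht, convexHull_min (fun v hv => ?_) (convex_convexHull ℝ _)⟩
    obtain ⟨θ, hθ, rfl⟩ := hsy v hv
    rw [htc, mem_convexHull_image_single_iff]
    have hJ := hy.gridPoint hm hθ
    exact ⟨hJ.nonneg, hJ.sum_eq_one, fun p hp => gridPoint_eq_zero m θ (by simpa [hc] using hp)⟩
  refine ⟨?_, Set.Subset.antisymm ?_ ?_, href⟩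
  · have h := (finite_range_gridPoint (G := G) (M := M) m)
    refine (h.toFinset.powerset.finite_toSet).subset ?_
    rintro s ⟨_, y, hy, hsy⟩
    simp only [Finset.coe_powerset, Set.mem_preimage, Set.mem_powerset_iff]
    intro v hv
    obtain ⟨θ, hθ, rfl⟩ := hsy v hv
    simpa using ⟨y, hy, θ, hθ, rfl⟩
  · intro x hx
    obtain ⟨s, hs, hxs⟩ := SimplicialComplex.mem_space_iff.mp hx
    obtain ⟨t, ht, hst⟩ := href s hs
    exact SimplicialComplex.mem_space_iff.mpr ⟨t, ht, hst hxs⟩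
  · intro x hx
    rw [mem_joinComplex_space_iff] at hx
    have hfin : ((fun θ => gridPoint m θ x) '' Set.Ico (0 : ℝ) 1).Finite := by
      refine (finite_range_gridPoint m).subset ?_
      rintro _ ⟨θ, hθ, rfl⟩
      exact ⟨x, hx, θ, hθ, rfl⟩
    refine SimplicialComplex.mem_space_iff.mpr ⟨hfin.toFinset, ⟨?_, x, hx, fun v hv => ?_⟩, ?_⟩
    · exact ⟨gridPoint m 0 x, by simpa using ⟨0, by simp, rfl⟩⟩
    · obtain ⟨θ, hθ, rfl⟩ := hfin.mem_toFinset.mp hv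
      exact ⟨θ, hθ, rfl⟩
    · rw [hfin.coe_toFinset]
      exact mem_convexHull_range_gridPoint hm hx

end GridComplex

/-! ### Fine invariant subdivisions of the join -/

section Invariance

variable {G : Type*} [Group G] {M : ℕ}

theorem joinRep_apply (g : G) (x : G × Fin M → ℝ) (p : G × Fin M) :
    joinRep G M g x p = x (g⁻¹ * p.1, p.2) := rfl

theorem partialSum_joinRep [Fintype G] (i : ℕ) (g : G) (x : G × Fin M → ℝ) :
    partialSum i (joinRep G M g x) = partialSum i x := by
  simp only [partialSum_apply, Finset.sum_filter]
  exact Fintype.sum_equiv ((Equiv.mulLeft g⁻¹).prodCongr (Equiv.refl _)) _ _ fun p => rfl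

theorem gridPoint_joinRep [Fintype G] (m : ℕ) (θ : ℝ) (g : G) (x : G × Fin M → ℝ) :
    gridPoint m θ (joinRep G M g x) = joinRep G M g (gridPoint m θ x) := by
  ext p
  simp only [gridPoint, partialSum_joinRep, joinRep_apply]

theorem InJoin.joinRep [Fintype G] {x : G × Fin M → ℝ} (hx : InJoin x) (g : G) :
    InJoin (joinRep G M g x) := by
  refine ⟨fun p => hx.nonneg _, ?_, fun k h i hk hh => ?_⟩
  · rw [← partialSum_last, partialSum_joinRep, partialSum_last, hx.sum_eq_one]
  · exact mul_left_cancel (hx.eq_of_ne_zero _ _ i hk hh)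

/-- If `g` fixes `x` and `(k, i)` is in its support, then so is `(g⁻¹ * k, i)`; the support has only
one element in copy `i`. -/
theorem InJoin.eq_one_of_joinRep_eq [Fintype G] {x : G × Fin M → ℝ} (hx : InJoin x) {g : G}
    (hg : TuckerBU.joinRep G M g x = x) : g = 1 := by
  obtain ⟨⟨k, i⟩, hk⟩ : ∃ p, x p ≠ 0 := by
    by_contra! H
    have := hx.sum_eq_one
    simp [H] at this
  have h : x (g⁻¹ * k, i) ≠ 0 := by
    have := congrFun hg (k, i)
    rw [joinRep_apply] at this
    rwa [this]
  simpa using hx.eq_of_ne_zero _ _ i h hk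

theorem isInvariant_gridComplex [Fintype G] {m : ℕ} (hm : 0 < m) :
    IsInvariant (joinRep G M) (gridComplex G M hm) := by
  classical
  rintro g s ⟨hne, y, hy, hsy⟩
  refine ⟨s.image (joinRep G M g), ⟨hne.image _, joinRep G M g y, hy.joinRep g, fun v hv => ?_⟩,
    Finset.coe_image⟩
  obtain ⟨u, hu, rfl⟩ := Finset.mem_image.mp hv
  obtain ⟨θ, hθ, rfl⟩ := hsy u hu
  exact ⟨θ, hθ, (gridPoint_joinRep m θ g y).symm⟩

theorem exists_fine_invariant_subdivision (G : Type*) [Group G] [Fintype G] (M : ℕ) {ε : ℝ}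
    (hε : 0 < ε) : ∃ K : SimplicialComplex ℝ (G × Fin M → ℝ), IsSubdivision K (joinComplex G M) ∧
      IsInvariant (joinRep G M) K ∧ ∀ s ∈ K.faces, ∀ u ∈ s, ∀ v ∈ s, dist u v < ε := by
  -- Each vertex of a grid simplex is within `1 / m` of the rounded point, so two of them are within
  -- `2 / m`.
  obtain ⟨m, hm⟩ := exists_nat_gt (2 / ε)
  have hm' : (0 : ℝ) < m := lt_trans (by positivity) hm
  have hm0 : 0 < m := by exact_mod_cast hm'
  refine ⟨gridComplex G M hm0, isSubdivision_gridComplex hm0, isInvariant_gridComplex hm0, ?_⟩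
  rintro s ⟨_, y, hy, hsy⟩ u hu v hv
  have key : ∀ v ∈ s, dist v y ≤ 1 / m := fun v hv => by
    obtain ⟨θ, hθ, rfl⟩ := hsy v hv
    exact (dist_pi_le_iff (by positivity)).mpr fun p => abs_gridPoint_sub_le hm0 θ y p
  calc dist u v ≤ dist u y + dist v y := dist_triangle_right _ _ _
    _ ≤ 1 / m + 1 / m := add_le_add (key u hu) (key v hv)
    _ = 2 / m := by ring
    _ < ε := by rwa [div_lt_comm₀ hm' hε]

/-- On a set on which `G` acts freely, choices that respect the action can be made equivariantly. -/
theorem exists_equivariant_choice {E V : Type*} [AddCommGroup E] [Module ℝ E] [AddCommGroup V]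
    [Module ℝ V] (ρ : Representation ℝ G E) (τ : Representation ℝ G V) {S : Set E}
    (hS : ∀ g, ∀ x ∈ S, ρ g x ∈ S) (hfree : ∀ g, ∀ x ∈ S, ρ g x = x → g = 1) {R : E → V → Prop}
    (hR : ∀ g, ∀ x ∈ S, ∀ b, R x b → R (ρ g x) (τ g b)) (hex : ∀ x ∈ S, ∃ b, R x b) :
    ∃ φ : E → V, (∀ x ∈ S, R x (φ x)) ∧ ∀ g, ∀ x ∈ S, φ (ρ g x) = τ g (φ x) := by
  let r : Setoid E := ⟨fun x y => ∃ g, ρ g x = y, fun x => ⟨1, by simp⟩,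
    fun {x y} ⟨g, hg⟩ => ⟨g⁻¹, by rw [← hg, ← Module.End.mul_apply, ← map_mul]; simp⟩,
    fun {x y z} ⟨g, hg⟩ ⟨h, hh⟩ => ⟨h * g, by rw [map_mul, Module.End.mul_apply, hg, hh]⟩⟩
  choose! b hb using hex
  -- Choose freely at one representative of each orbit and transport by `γ x`, which carries it to
  -- `x`; freeness on `S` makes `γ` equivariant there.
  let rep : E → E := fun x => (Quotient.mk r x).out
  choose γ hγ using fun x : E => (Quotient.exact (Quotient.out_eq (Quotient.mk r x)) :
    ∃ g, ρ g (rep x) = x)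
  have hrep : ∀ g x, rep (ρ g x) = rep x := fun g x =>
    congrArg Quotient.out (Quotient.sound (⟨g⁻¹, by
      rw [← Module.End.mul_apply, ← map_mul]; simp⟩ : ∃ h, ρ h (ρ g x) = x))
  have hrepS : ∀ x ∈ S, rep x ∈ S := fun x hx => by
    have h := hS (γ x)⁻¹ x hx
    nth_rewrite 2 [← hγ x] at h
    rwa [← Module.End.mul_apply, ← map_mul, inv_mul_cancel, map_one] at h
  refine ⟨fun x => τ (γ x) (b (rep x)), fun x hx => ?_, fun g x hx => ?_⟩
  · have := hR (γ x) _ (hrepS x hx) _ (hb _ (hrepS x hx))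
    rwa [hγ] at this
  · have h1 : ρ (γ (ρ g x)) (rep x) = ρ g (ρ (γ x) (rep x)) := by
      rw [hγ x, ← hrep g x, hγ]
    have h2 : γ (ρ g x) = g * γ x := by
      have h3 : ρ ((g * γ x)⁻¹ * γ (ρ g x)) (rep x) = rep x := by
        rw [map_mul, Module.End.mul_apply, h1, ← Module.End.mul_apply, ← Module.End.mul_apply,
          ← map_mul, ← map_mul]
        simp
      have h4 := hfree _ _ (hrepS x hx) h3
      rw [inv_mul_eq_one] at h4
      exact h4.symm
    simp only [hrep, h2, map_mul, Module.End.mul_apply]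

end Invariance

/-! ### Vertices of the crosspolytope -/

section Crosspolytope

variable {G : Type*} [Group G] [Fintype G] {n : ℕ}

theorem wPowRep_apply (g : G) (y : Fin n → W G) (i : Fin n) (h : G) :
    (wPowRep G n g y i : G → ℝ) h = (y i : G → ℝ) (g⁻¹ * h) := rfl

theorem sum_coe_W {G : Type*} [Fintype G] (y : W G) : ∑ h, (y : G → ℝ) h = 0 := y.2

/-- The label `(i, g)`: the vertex of the crosspolytope in the `i`-th copy of `W G` that comes from
the basis vector of `g`. -/
noncomputable def label (i : Fin n) (g : G) : Fin n → W G := Pi.single i (wVertex G g)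

theorem label_apply_self (i : Fin n) (g : G) :
    (label i g i : G → ℝ) g = 1 - 1 / (Fintype.card G : ℝ) := by
  simp [label, wVertex]

theorem label_apply_of_ne (i : Fin n) {g h : G} (hgh : h ≠ g) :
    (label i g i : G → ℝ) h = -(1 / (Fintype.card G : ℝ)) := by
  classical
  simp [label, wVertex, Pi.single_apply, hgh]

theorem label_apply_of_index_ne {i j : Fin n} (hij : j ≠ i) (g h : G) :
    (label i g j : G → ℝ) h = 0 := by
  simp [label, Pi.single_eq_of_ne hij]

theorem wPowRep_label (g : G) (i : Fin n) (h : G) :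
    wPowRep G n g (label i h) = label i (g * h) := by
  ext j k
  rw [wPowRep_apply]
  by_cases hj : j = i
  · subst hj
    by_cases hk : k = g * h
    · subst hk
      rw [label_apply_self, inv_mul_cancel_left, label_apply_self]
    · rw [label_apply_of_ne _ hk, label_apply_of_ne]
      rwa [Ne, inv_mul_eq_iff_eq_mul]
  · rw [label_apply_of_index_ne hj, label_apply_of_index_ne hj]

theorem label_injective [Nontrivial G] {i j : Fin n} {g h : G} (hl : label i g = label j h) :
    i = j ∧ g = h := by
  have hk : (1 : ℝ) < Fintype.card G := by exact_mod_cast Fintype.one_lt_card (α := G)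
  have hk' : 1 / (Fintype.card G : ℝ) < 1 := by
    rw [div_lt_one (by linarith)]; exact hk
  have hk0 : 0 < 1 / (Fintype.card G : ℝ) := by positivity
  have h1 : (label i g i : G → ℝ) g = (label j h i : G → ℝ) g := by rw [hl]
  rw [label_apply_self] at h1
  by_cases hij : i = j
  · subst hij
    refine ⟨rfl, ?_⟩
    by_contra hgh
    rw [label_apply_of_ne _ hgh] at h1
    linarith
  · rw [label_apply_of_index_ne hij] at h1
    linarith

/-- For the trivial group all labels are 0 and cannot be told apart; this excludes that case
whenever a coordinate is positive. -/
theorem nontrivial_of_coe_W_pos {G : Type*} [Fintype G] {y : W G} {g : G} (hy : 0 < (y : G → ℝ) g) : Nontrivial G := by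
  by_contra H
  rw [not_nontrivial_iff_subsingleton] at H
  have := sum_coe_W y
  rw [Fintype.sum_subsingleton _ g] at this
  linarith

theorem mem_extremePoints_convexHull {V : Type*} [AddCommGroup V] [Module ℝ V] {S : Set V}
    {u : V} (hu : u ∈ S) (ℓ : V →ₗ[ℝ] ℝ) (hℓ : ∀ v ∈ S, v ≠ u → ℓ v < ℓ u) :
    u ∈ (convexHull ℝ S).extremePoints ℝ := by
  -- This set is an open half-space together with the boundary point `u`.
  have hconv : Convex ℝ {v | v ≠ u → ℓ v < ℓ u} := by
    intro x hx y hy a b ha hb hab hne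
    have hle : ∀ v, (v ≠ u → ℓ v < ℓ u) → ℓ v ≤ ℓ u := fun v hv => by
      by_cases h : v = u
      · rw [h]
      · exact (hv h).le
    rw [map_add, map_smul, map_smul, smul_eq_mul, smul_eq_mul]
    have hsum : ℓ u = a * ℓ u + b * ℓ u := by rw [← add_mul, hab, one_mul]
    have h1 := mul_le_mul_of_nonneg_left (hle x hx) ha
    have h2 := mul_le_mul_of_nonneg_left (hle y hy) hb
    refine lt_of_le_of_ne (by linarith) fun heq => hne ?_
    have h3 : a • x = a • u := by
      by_cases hxu : x = u
      · rw [hxu]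
      · rcases ha.eq_or_lt with h | h
        · simp [← h]
        · have := mul_lt_mul_of_pos_left (hx hxu) h
          linarith
    have h4 : b • y = b • u := by
      by_cases hyu : y = u
      · rw [hyu]
      · rcases hb.eq_or_lt with h | h
        · simp [← h]
        · have := mul_lt_mul_of_pos_left (hy hyu) h
          linarith
    rw [h3, h4, ← add_smul, hab, one_smul]
  have hall : ∀ v ∈ convexHull ℝ S, v ≠ u → ℓ v < ℓ u := fun v hv =>
    convexHull_min (t := {v | v ≠ u → ℓ v < ℓ u}) hℓ hconv hv
  refine ⟨subset_convexHull ℝ S hu, fun x hx y hy ⟨a, b, ha, hb, hab, hxy⟩ => ?_⟩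
  by_contra hne
  have h1 := mul_lt_mul_of_pos_left (hall x hx hne) ha
  have h2 : ℓ y ≤ ℓ u := by
    by_cases h : y = u
    · rw [h]
    · exact (hall y hy h).le
  have h2 := mul_le_mul_of_nonneg_left h2 hb.le
  have h3 := congrArg ℓ hxy
  rw [map_add, map_smul, map_smul, smul_eq_mul, smul_eq_mul] at h3
  have hsum : ℓ u = a * ℓ u + b * ℓ u := by rw [← add_mul, hab, one_mul]
  linarith

/-- The coordinate at `g` in copy `i` is `1 - 1 / k` on this label, with `k` the order of `G`, and
`-1 / k` or 0 on all others, so it is maximized there alone. -/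
theorem label_mem_extremePoints [Nontrivial G] (i : Fin n) (g : G) :
    label i g ∈ (crosspolytope G n).extremePoints ℝ := by
  have hS : crosspolytope G n = convexHull ℝ (Set.range fun p : Fin n × G => label p.1 p.2) := by
    refine Set.Subset.antisymm (convexHull_min (Set.iUnion_subset fun i => convexHull_mono ?_)
      (convex_convexHull ℝ _)) (convexHull_mono ?_)
    · rintro _ ⟨g, rfl⟩
      exact ⟨(i, g), rfl⟩
    · rintro _ ⟨⟨i, g⟩, rfl⟩
      exact Set.mem_iUnion.mpr ⟨i, subset_convexHull ℝ _ ⟨g, rfl⟩⟩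
  have hk : (1 : ℝ) < Fintype.card G := by exact_mod_cast Fintype.one_lt_card (α := G)
  have hk' : 1 / (Fintype.card G : ℝ) < 1 := by
    rw [div_lt_one (by linarith)]; exact hk
  have hk0 : 0 < 1 / (Fintype.card G : ℝ) := by positivity
  rw [hS]
  refine mem_extremePoints_convexHull ⟨(i, g), rfl⟩
    ((LinearMap.proj g).comp ((W G).subtype.comp (LinearMap.proj i))) ?_
  rintro _ ⟨⟨j, h⟩, rfl⟩ hne
  simp only [LinearMap.comp_apply, LinearMap.proj_apply, Submodule.subtype_apply]
  rw [label_apply_self]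
  by_cases hij : i = j
  · subst hij
    have hgh : g ≠ h := fun hgh => hne (by rw [hgh])
    rw [label_apply_of_ne _ hgh]
    linarith
  · rw [label_apply_of_index_ne hij]
    linarith

/-- If `0` is a convex combination of labels, then all labels of some copy of `W G` occur. -/
theorem exists_forall_label_mem {S : Set (Fin n → W G)}
    (hS : ∀ v ∈ S, ∃ i g, v = label i g) (h0 : (0 : Fin n → W G) ∈ convexHull ℝ S) :
    ∃ i, ∀ g, label i g ∈ S := by
  by_contra! H
  choose γ hγ using H
  have hk0 : 0 < 1 / (Fintype.card G : ℝ) := by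
    have := Fintype.card_pos (α := G)
    positivity
  -- If each copy `i` misses a label `γ i`, the sum of the coordinates at the `γ i` is `-1 / k` on
  -- every label in `S`, where `k` is the order of `G`; so 0 is not in the hull.
  let ℓ : (Fin n → W G) →ₗ[ℝ] ℝ :=
    ∑ i, (LinearMap.proj (γ i)).comp ((W G).subtype.comp (LinearMap.proj i))
  have hℓ : ∀ y : Fin n → W G, ℓ y = ∑ i, (y i : G → ℝ) (γ i) := fun y => by simp [ℓ]
  have hneg : S ⊆ {y | ℓ y < 0} := by
    intro v hv
    obtain ⟨i, g, rfl⟩ := hS v hv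
    have hg : γ i ≠ g := by rintro rfl; exact hγ i hv
    rw [Set.mem_ofPred_eq, hℓ,
      Fintype.sum_eq_single i fun j hj => label_apply_of_index_ne hj _ _, label_apply_of_ne _ hg]
    linarith
  have := convexHull_min hneg (convex_halfSpace_lt ℓ.isLinear 0) h0
  simp at this

end Crosspolytope

/-! ### The theorem -/

/-- If all invariant subdivisions of a join give Tucker triples, then the join gives a Borsuk-Ulam
pair. -/
theorem isBorsukUlamPair_of_forall_isTuckerTriple (G : Type*) [Group G] [Fintype G] {n : ℕ}
    (hn : 1 ≤ n) (M : ℕ)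
    (h : ∀ K : SimplicialComplex ℝ (G × Fin M → ℝ), IsSubdivision K (joinComplex G M) →
      IsInvariant (joinRep G M) K →
      IsTuckerTriple (joinRep G M) K (wPowRep G n) (crosspolytope G n)) :
    IsBorsukUlamPair (joinRep G M) (joinComplex G M) (wPowRep G n) := by
  intro f hfc hfe
  by_contra! hf
  have : Nonempty (Fin n) := ⟨⟨0, hn⟩⟩
  have hcoord : ∀ i g, ContinuousOn (fun x => (f x i : G → ℝ) g) (joinComplex G M).space :=
    fun i g => (show Continuous fun y : Fin n → W G => (y i : G → ℝ) g from
      (continuous_apply g).comp (continuous_subtype_val.comp (continuous_apply i))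
      ).comp_continuousOn hfc
  -- The sum of the positive parts vanishes only where all coordinates are nonpositive; as they sum
  -- to 0 in each copy, `f` would vanish there.
  obtain ⟨ε, hε, hεF⟩ := (isCompact_joinComplex_space G M).exists_forall_le'
    (f := fun x => ∑ q : Fin n × G, max 0 ((f x q.1 : G → ℝ) q.2)) (a := 0)
    (continuousOn_finsetSum _ fun q _ => continuousOn_const.sup (hcoord q.1 q.2)) (by
      intro x hx
      refine lt_of_le_of_ne (Finset.sum_nonneg fun q _ => le_max_left _ _) fun heq => hf x hx ?_
      have h1 := (Finset.sum_eq_zero_iff_of_nonneg fun q _ => le_max_left _ _).mp heq.symm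
      have h2 : ∀ i g, (f x i : G → ℝ) g ≤ 0 := fun i g => by
        simpa using h1 (i, g) (Finset.mem_univ _)
      ext i g
      exact (Finset.sum_eq_zero_iff_of_nonpos fun g _ => h2 i g).mp (sum_coe_W (f x i)) g
        (Finset.mem_univ g))
  -- Of the `card (Fin n × G)` positive parts with sum at least `ε`, one is at least the average
  -- `δ`.
  set δ : ℝ := ε / Fintype.card (Fin n × G) with hδdef
  have hcard : (0 : ℝ) < Fintype.card (Fin n × G) := by exact_mod_cast Fintype.card_pos
  have hδ : 0 < δ := div_pos hε hcard
  have hδf : ∀ x ∈ (joinComplex G M).space, ∃ i g, δ ≤ (f x i : G → ℝ) g := by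
    intro x hx
    obtain ⟨⟨i, g⟩, _, hq⟩ := Finset.exists_le_of_sum_le (s := Finset.univ)
      (f := fun _ : Fin n × G => δ) (g := fun q => max 0 ((f x q.1 : G → ℝ) q.2))
      Finset.univ_nonempty (by
        refine le_trans (le_of_eq ?_) (hεF x hx)
        rw [Finset.sum_const, Finset.card_univ, nsmul_eq_mul, hδdef]
        field_simp)
    exact ⟨i, g, (le_max_iff.mp hq).resolve_left (not_le.mpr hδ)⟩
  obtain ⟨η, hη, hηf⟩ := Metric.uniformContinuousOn_iff.mp
    ((isCompact_joinComplex_space G M).uniformContinuousOn_of_continuous hfc) δ hδ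
  obtain ⟨K, hK, hKinv, hKfine⟩ := exists_fine_invariant_subdivision G M hη
  obtain ⟨φ, hφ, hφe⟩ := exists_equivariant_choice (joinRep G M) (wPowRep G n)
    (S := (joinComplex G M).space)
    (R := fun x b => ∃ i g, b = label i g ∧ δ ≤ (f x i : G → ℝ) g)
    (fun g x hx => by
      rw [mem_joinComplex_space_iff] at hx ⊢
      exact hx.joinRep g)
    (fun g x hx hgx => ((mem_joinComplex_space_iff x).mp hx).eq_one_of_joinRep_eq hgx)
    (by
      rintro g x hx _ ⟨i, k, rfl, hk⟩
      refine ⟨i, g * k, wPowRep_label g i k, ?_⟩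
      rw [hfe g x hx, wPowRep_apply, inv_mul_cancel_left]
      exact hk)
    (fun x hx => by
      obtain ⟨i, g, hig⟩ := hδf x hx
      exact ⟨_, i, g, rfl, hig⟩)
  have hspace : ∀ s ∈ K.faces, ∀ v ∈ s, v ∈ (joinComplex G M).space := fun s hs v hv =>
    hK.space_eq ▸ K.subset_space hs hv
  obtain ⟨s, hs, h0⟩ := h K hK hKinv φ
    (fun v hv => by
      have hv' := hK.space_eq ▸ K.vertices_subset_space hv
      obtain ⟨i, g, hφv, hg⟩ := hφ v hv'
      have := nontrivial_of_coe_W_pos (hδ.trans_le hg)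
      rw [hφv]
      exact label_mem_extremePoints i g)
    (fun g v hv => hφe g v (hK.space_eq ▸ K.vertices_subset_space hv))
  obtain ⟨i, hi⟩ := exists_forall_label_mem (by
    rintro _ ⟨v, hv, rfl⟩
    obtain ⟨i, g, hφv, _⟩ := hφ v (hspace s hs v hv)
    exact ⟨i, g, hφv⟩) h0
  obtain ⟨v₀, hv₀⟩ := K.nonempty_of_mem_faces hs
  -- For each `g` the vertex labelled `(i, g)` has that coordinate at least `δ`, and moving to `v₀`
  -- changes it by less than `δ`; all coordinates of `f v₀ i` are thus positive.
  refine (Finset.sum_pos (s := Finset.univ) (f := fun g => (f v₀ i : G → ℝ) g) (fun g _ => ?_)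
    Finset.univ_nonempty).ne' (sum_coe_W (f v₀ i))
  obtain ⟨v, hv, hvg⟩ := hi g
  obtain ⟨j, k, hφv, hk⟩ := hφ v (hspace s hs v hv)
  have := nontrivial_of_coe_W_pos (hδ.trans_le hk)
  obtain ⟨rfl, rfl⟩ := label_injective (hvg.symm.trans hφv)
  have hdist := hηf v (hspace s hs v hv) v₀ (hspace s hs v₀ hv₀) (hKfine s hs v hv v₀ hv₀)
  have h1 : dist ((f v i : G → ℝ) g) ((f v₀ i : G → ℝ) g) < δ :=
    ((dist_le_pi_dist _ _ g).trans (dist_le_pi_dist (f v) (f v₀) i)).trans_lt hdist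
  rw [Real.dist_eq] at h1
  linarith [(abs_lt.mp h1).2]

theorem borsukUlamProperty_of_tuckerProperty (G : Type*) [Group G] [Fintype G]
    (h : TuckerProperty G) : BorsukUlamProperty G := fun n hn =>
  isBorsukUlamPair_of_forall_isTuckerTriple G hn _ (h n hn)

end TuckerBU

theorem mainTheorem1 (G : Type*) [Group G] [Fintype G] :
    TuckerBU.TuckerProperty G ↔ TuckerBU.BorsukUlamProperty G :=
  ⟨TuckerBU.borsukUlamProperty_of_tuckerProperty G, TuckerBU.tuckerProperty_of_borsukUlamProperty G⟩
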